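/- **ProbNetKAT.** Fix finitely many fields $f_1,\dots,f_k$, where field $f$ takes integer values in $\{0,\dots,m_f-1\}$. A packet $\pi$ is a record assigning a value to each field; a history $h=\pi{:}\hbar$ is a non-empty list of packets with head $\pi$ and tail $\hbar$; let $H$ be the (countable) set of histories. Predicates and programs are generated by $$t,u ::= \mathsf{drop}\mid \mathsf{skip}\mid f=n\mid t\mathbin{\&}u\mid t;u\mid \neg t,\qquad p,q ::= t\mid f\leftarrow n\mid \mathsf{dup}\mid p\mathbin{\&}q\mid p;q\mid p\oplus_r q\mid p^*\qquad(r\in[0,1]).$$ **Kernels.** Equip $2^H$ with the $\sigma$-algebra $\mathcal B$ generated by the sets $\{c\subseteq H : h\in c\}$, $h\in H$ (equivalently, the Borel sets of the Cantor topology). For Markov kernels $P,Q$ from $(2^H,\mathcal B)$ to itself, write $P\sqsubseteq Q$ if $P(a,B)\le Q(a,B)$ for all $a\subseteq H$ and all $B\subseteq 2^H$ that are Scott-open for inclusion, i.e. up-closed and meeting every non-empty directed family whose union lies in $B$. This is a partial order. Let $P\mathbin{\&}Q$ send $a$ to the law of $b_1\cup b_2$ for independent $b_1\sim P(a,-)$,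 $b_2\sim Q(a,-)$; let $(P;Q)(a,A)=\int P(a,dc)\,Q(c,A)$; let $P\oplus_r Q=rP+(1-r)Q$; let $P^{(0)}=\mathsf{skip}=(a\mapsto\delta_a)$ and $P^{(n+1)}=\mathsf{skip}\mathbin{\&}(P;P^{(n)})$, which is a $\sqsubseteq$-increasing chain; and let $P^*=\bigsqcup_{n}P^{(n)}$ be its $\sqsubseteq$-least upper bound, which exists. **Semantics.** The denotation $[\![p]\!]$ is the Markov kernel given by: $[\![\mathsf{drop}]\!](a)=\delta_\emptyset$; $[\![\mathsf{skip}]\!](a)=\delta_a$; $[\![f=n]\!](a)=\delta_{\{\pi:\hbar\in a\,:\,\pi.f=n\}}$; $[\![\neg t]\!](a)$ is the law of $a\setminus b$ for $b\sim[\![t]\!](a)$; $[\![f\leftarrow n]\!](a)=\delta_{\{\pi[f:=n]:\hbar\,\mid\,\pi:\hbar\in a\}}$; $[\![\mathsf{dup}]\!](a)=\delta_{\{\pi:\pi:\hbar\,\mid\,\pi:\hbar\in a\}}$; and $\&$, $;$, $\oplus_r$, ${}^*$ are interpreted by the operations on kernels above. **Approximants.** For a program $p$ put $p^{(0)}=\mathsf{skip}$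 and $p^{(n+1)}=\mathsf{skip}\mathbin{\&}(p;p^{(n)})$. The $n$-th approximant $[p]_n$ is defined by $[p]_n=p$ if $p$ is a predicate, a modification or $\mathsf{dup}$; $[q\mathbin{\&}r]_n=[q]_n\mathbin{\&}[r]_n$; $[q;r]_n=[q]_n;[r]_n$; $[q\oplus_s r]_n=[q]_n\oplus_s[r]_n$; and $[q^*]_n=([q]_n)^{(n)}$. Write $[\![p]\!]_n=[\![\,[p]_n\,]\!]$. **Theorem.** For every program $p$, $$[\![p]\!]_0\sqsubseteq[\![p]\!]_1\sqsubseteq[\![p]\!]_2\sqsubseteq\cdots\qquad\text{and}\qquad\bigsqcup_{n\ge0}[\![p]\!]_n=[\![p]\!],$$ where $\bigsqcup$ denotes the least upper bound with respect to $\sqsubseteq$ among all Markov kernels on $(2^H,\mathcal B)$. -/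

import Mathlib

open MeasureTheory ProbabilityTheory Set Filter

open scoped ENNReal Topology

namespace ProbNetKAT

/-! ### Sets of histories: Scott topology, Cantor topology, Borel sets -/

section Order

variable {H : Type}

/-- Scott-open sets of the dcpo `(Set H, ⊆)`. -/
def ScottOpen (B : Set (Set H)) : Prop := IsOpen[Topology.scott (Set H) univ] B

/-- Scott-open means: up-closed, and meeting every nonempty directed set whose union it contains. -/
theorem scottOpen_iff {B : Set (Set H)} :
    ScottOpen B ↔ IsUpperSet B ∧ ∀ D : Set (Set H), D.Nonempty → DirectedOn (· ⊆ ·) D →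
      ⋃₀ D ∈ B → (D ∩ B).Nonempty := by
  let _ : TopologicalSpace (Set H) := Topology.scott (Set H) univ
  have _ : Topology.IsScott (Set H) univ := ⟨rfl⟩
  have h : ScottOpen B ↔ IsUpperSet B ∧ DirSupInacc B := by
    rw [← dirSupInaccOn_univ]
    exact Topology.IsScott.isOpen_iff_isUpperSet_and_dirSupInaccOn (D := univ)
  rw [h]
  refine and_congr_right fun _ => ⟨fun hB D hD hdir hmem => hB hD hdir (isLUB_sSup D) hmem, ?_⟩
  intro hB D hD hdir a ha hmem
  refine hB D hD hdir ?_
  have : a = ⋃₀ D := ha.unique (isLUB_sSup D)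
  rwa [← this]

/-- The Cantor topology on `Set H`, generated by the sets `{c | h ∈ c}` and their complements. -/
@[reducible]
def cantorTopology (H : Type) : TopologicalSpace (Set H) :=
  TopologicalSpace.generateFrom {U | ∃ h : H, U = {c | h ∈ c} ∨ U = {c | h ∈ c}ᶜ}

/-- The σ-algebra that Mathlib puts on `Set H` is the Borel algebra of the Cantor topology. -/
theorem measurableSpace_eq_borel [Countable H] :
    (Set.instMeasurableSpace : MeasurableSpace (Set H)) = @borel (Set H) (cantorTopology H) := by
  let _ : TopologicalSpace (Set H) := cantorTopology H
  have hc : {U : Set (Set H) | ∃ h : H, U = {c | h ∈ c} ∨ U = {c | h ∈ c}ᶜ}.Countable := by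
    have : {U : Set (Set H) | ∃ h : H, U = {c | h ∈ c} ∨ U = {c | h ∈ c}ᶜ} ⊆
        range (fun h : H => {c : Set H | h ∈ c}) ∪ range (fun h : H => {c : Set H | h ∈ c}ᶜ) := by
      rintro U ⟨h, rfl | rfl⟩
      · exact Or.inl ⟨h, rfl⟩
      · exact Or.inr ⟨h, rfl⟩
    exact ((countable_range _).union (countable_range _)).mono this
  have _ : SecondCountableTopology (Set H) := ⟨⟨_, hc, rfl⟩⟩
  rw [borel_eq_generateFrom_of_subbasis (t := cantorTopology H) rfl]
  refine le_antisymm ?_ (MeasurableSpace.generateFrom_le ?_)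
  · let m₀ : MeasurableSpace (Set H) := .generateFrom
      {U | ∃ h : H, U = {c | h ∈ c} ∨ U = {c | h ∈ c}ᶜ}
    have : @Measurable (Set H) (Set H) m₀ Set.instMeasurableSpace id :=
      (measurable_set_iff (g := id)).2 fun h => (measurableSet_setOfPred (p := fun c : Set H => h ∈ c)).1
        (MeasurableSpace.measurableSet_generateFrom (s := {U | ∃ h : H, U = {c | h ∈ c} ∨ U = {c | h ∈ c}ᶜ}) ⟨h, Or.inl rfl⟩)
    intro s hs
    exact this hs
  · rintro U ⟨h, rfl | rfl⟩
    · exact measurableSet_mem h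
    · exact (measurableSet_mem h).compl

/-- The finite union of the basic Scott-open sets `{c | b ⊆ c}`, `b ∈ t`. -/
def basicUnion (t : Finset (Finset H)) : Set (Set H) := {c | ∃ b ∈ t, (b : Set H) ⊆ c}

theorem scottOpen_basicUnion (t : Finset (Finset H)) : ScottOpen (basicUnion t) := by
  refine scottOpen_iff.2 ⟨fun c d hcd ⟨b, hb, hbc⟩ => ⟨b, hb, hbc.trans hcd⟩, ?_⟩
  rintro D hD hdir ⟨b, hb, hbc⟩
  obtain ⟨d, hd, hbd⟩ := hdir.exists_mem_subset_of_finset_subset_biUnion hD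
    (s := b) (f := fun x => x) (by simpa [sUnion_eq_biUnion] using hbc)
  exact ⟨d, hd, b, hb, hbd⟩

theorem ScottOpen.eq_iUnion {B : Set (Set H)} (hB : ScottOpen B) :
    B = ⋃ t : Finset {b : Finset H // (b : Set H) ∈ B}, basicUnion (t.map (.subtype _)) := by
  obtain ⟨hup, hdir⟩ := scottOpen_iff.1 hB
  ext c
  simp only [mem_iUnion, basicUnion, mem_ofPred_eq]
  constructor
  · intro hc
    obtain ⟨_, ⟨b, hb, rfl⟩, hbB⟩ := hdir ((fun b : Finset H => (b : Set H)) '' {b | ↑b ⊆ c})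
      ⟨_, ∅, by simp, rfl⟩ (by
        classical
        rintro _ ⟨b, hb, rfl⟩ _ ⟨b', hb', rfl⟩
        refine ⟨_, ⟨b ∪ b', ?_, rfl⟩, ?_, ?_⟩
        · simp only [mem_ofPred_eq, Finset.coe_union, union_subset_iff]
          exact ⟨hb, hb'⟩
        · simp
        · simp) (by
        convert hc
        ext x
        simp only [mem_sUnion, mem_image, mem_ofPred_eq]
        constructor
        · rintro ⟨_, ⟨b, hb, rfl⟩, hx⟩
          exact hb hx
        · intro hx
          exact ⟨_, ⟨{x}, by simpa using hx, rfl⟩, by simp⟩)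
    exact ⟨{⟨b, hbB⟩}, b, by simpa using hbB, hb⟩
  · rintro ⟨t, b, hb, hbc⟩
    simp only [Finset.mem_map, Function.Embedding.subtype_apply] at hb
    obtain ⟨⟨b', hb'⟩, -, rfl⟩ := hb
    exact hup hbc hb'

theorem directed_basicUnion (B : Set (Set H)) : Directed (· ⊆ ·)
    fun t : Finset {b : Finset H // (b : Set H) ∈ B} => basicUnion (t.map (.subtype _)) := by
  classical
  intro s t
  have key : ∀ u v : Finset {b : Finset H // (b : Set H) ∈ B}, u ⊆ v →
      basicUnion (u.map (.subtype _)) ⊆ basicUnion (v.map (.subtype _)) :=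
    fun u v huv c ⟨b, hb, hbc⟩ => ⟨b, Finset.map_subset_map.2 huv hb, hbc⟩
  exact ⟨s ∪ t, key _ _ Finset.subset_union_left, key _ _ Finset.subset_union_right⟩

/-- The sets `{c | b ⊆ c}` with `b` finite. -/
def basicSets (H : Type) : Set (Set (Set H)) := range fun b : Finset H => basicUnion {b}

theorem isPiSystem_basicSets : IsPiSystem (basicSets H) := by
  classical
  rintro _ ⟨b, rfl⟩ _ ⟨b', rfl⟩ -
  refine ⟨b ∪ b', ?_⟩
  ext c
  simp [basicUnion]

theorem generateFrom_basicSets :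
    (Set.instMeasurableSpace : MeasurableSpace (Set H)) = .generateFrom (basicSets H) := by
  refine le_antisymm ?_ (MeasurableSpace.generateFrom_le ?_)
  · let m₀ : MeasurableSpace (Set H) := .generateFrom (basicSets H)
    have : @Measurable (Set H) (Set H) m₀ Set.instMeasurableSpace id :=
      (measurable_set_iff (g := id)).2 fun h => (measurableSet_setOfPred (p := fun c : Set H => h ∈ c)).1
        (MeasurableSpace.measurableSet_generateFrom (s := basicSets H)
          ⟨{h}, by ext; simp [basicUnion]⟩)
    intro s hs
    exact this hs
  · rintro _ ⟨b, rfl⟩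
    have : basicUnion {b} = ⋂ h ∈ b, {c : Set H | h ∈ c} := by
      ext c
      simp [basicUnion, subset_def]
    change MeasurableSet (basicUnion {b})
    rw [this]
    exact Finset.measurableSet_biInter _ fun h _ => measurableSet_mem h

variable [Countable H]

theorem measure_eq_iSup_basicUnion (μ : Measure (Set H)) {B : Set (Set H)} (hB : ScottOpen B) :
    μ B = ⨆ t : Finset {b : Finset H // (b : Set H) ∈ B},
      μ (basicUnion (t.map (.subtype _))) := by
  conv_lhs => rw [hB.eq_iUnion]
  exact (directed_basicUnion B).measure_iUnion

theorem measurableSet_of_scottOpen {B : Set (Set H)} (hB : ScottOpen B) : MeasurableSet B := by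
  rw [hB.eq_iUnion]
  refine .iUnion fun t => ?_
  have : basicUnion (t.map (.subtype _)) = ⋃ b ∈ t.map (.subtype _), basicUnion {b} := by
    ext c
    simp [basicUnion]
  rw [this]
  refine Finset.measurableSet_biUnion _ fun b _ => ?_
  rw [generateFrom_basicSets]
  exact MeasurableSpace.measurableSet_generateFrom ⟨b, rfl⟩

/-- A chain of probability measures has a limit that is the supremum on Scott-open sets. -/
theorem exists_measure_iSup (μ : ℕ → Measure (Set H)) [∀ n, IsProbabilityMeasure (μ n)]
    (hμ : ∀ B, ScottOpen B → Monotone fun n => μ n B) :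
    ∃ ν : Measure (Set H), IsProbabilityMeasure ν ∧ ∀ B, ScottOpen B → ν B = ⨆ n, μ n B := by
  classical
  let f : Set H → H → Bool := fun c h => decide (h ∈ c)
  let g : (H → Bool) → Set H := fun x => {h | x h = true}
  have hf : Measurable f := by
    refine measurable_pi_iff.2 fun h => ?_
    refine measurable_to_bool ?_
    convert measurableSet_mem h using 1
    ext c
    simp [f]
  have hg : Measurable g := by
    refine measurable_set_iff.2 fun h => measurableSet_setOfPred.1 ?_
    exact (measurable_pi_apply (X := fun _ : H => Bool) h) (measurableSet_singleton true)
  have hfg : ∀ c, g (f c) = c := fun c => by ext; simp [f, g]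
  let μ' : ℕ → ProbabilityMeasure (H → Bool) := fun n =>
    ⟨(μ n).map f, Measure.isProbabilityMeasure_map hf.aemeasurable⟩
  obtain ⟨ν', -, hν'⟩ := isCompact_univ.ultrafilter_le_nhds ((hyperfilter ℕ).map μ') (by simp)
  have hlim : Tendsto μ' (hyperfilter ℕ) (𝓝 ν') := hν'
  have hclopen : ∀ t : Finset (Finset H), IsClopen (g ⁻¹' basicUnion t) := by
    intro t
    have : g ⁻¹' basicUnion t = ⋃ b ∈ t, ⋂ h ∈ b, {x : H → Bool | x h = true} := by
      ext x
      simp [basicUnion, g, subset_def]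
    rw [this]
    refine isClopen_biUnion_finset fun b _ => isClopen_biInter_finset fun h _ => ?_
    exact (isClopen_discrete {true}).preimage (continuous_apply h)
  have hprob : IsProbabilityMeasure ((ν' : Measure (H → Bool)).map g) :=
    Measure.isProbabilityMeasure_map hg.aemeasurable
  have hbasic : ∀ t : Finset (Finset H),
      (ν' : Measure (H → Bool)).map g (basicUnion t) = ⨆ n, μ n (basicUnion t) := by
    intro t
    have hm := measurableSet_of_scottOpen (scottOpen_basicUnion t)
    have h1 := ProbabilityMeasure.tendsto_measure_of_null_frontier_of_tendsto' hlim
      (E := g ⁻¹' basicUnion t) (by simp [(hclopen t).frontier_eq])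
    rw [Measure.map_apply hg hm]
    refine tendsto_nhds_unique h1 ?_
    have h2 := (tendsto_atTop_iSup (hμ _ (scottOpen_basicUnion t))).mono_left
      Nat.hyperfilter_le_atTop
    refine h2.congr fun n => ?_
    change _ = (μ n).map f _
    rw [Measure.map_apply hf (hg hm), ← preimage_comp]
    congr 1
    ext c
    simp [hfg]
  refine ⟨_, hprob, fun B hB => ?_⟩
  rw [measure_eq_iSup_basicUnion _ hB]
  simp_rw [hbasic, measure_eq_iSup_basicUnion (μ _) hB]
  exact iSup_comm

end Order

/-! ### Markov kernels on sets of histories -/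

/-- Markov kernels with source and target `(Set H, Borel sets)`; for the σ-algebra see
`measurableSpace_eq_borel`. -/
structure MKernel (H : Type) where
  /-- the underlying kernel -/
  ker : Kernel (Set H) (Set H)
  isMarkov : IsMarkovKernel ker

attribute [instance] MKernel.isMarkov

namespace MKernel

variable {H : Type}

theorem measurable_union : Measurable fun x : Set H × Set H => x.1 ∪ x.2 :=
  measurable_set_iff.2 fun h => measurableSet_setOfPred.1
    ((measurable_fst (measurableSet_mem h)).union (measurable_snd (measurableSet_mem h)))

theorem measurable_sdiff : Measurable fun x : Set H × Set H => x.1 \ x.2 :=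
  measurable_set_iff.2 fun h => measurableSet_setOfPred.1
    ((measurable_fst (measurableSet_mem h)).diff (measurable_snd (measurableSet_mem h)))

theorem scottOpen_union (a : Set H) {B : Set (Set H)} (hB : ScottOpen B) :
    ScottOpen {b | a ∪ b ∈ B} := by
  obtain ⟨hup, hdir⟩ := scottOpen_iff.1 hB
  refine scottOpen_iff.2 ⟨fun c d hcd hc => hup (union_subset_union_right a hcd) hc, ?_⟩
  intro D hD hD' hmem
  obtain ⟨_, ⟨d, hd, rfl⟩, hdB⟩ := hdir ((a ∪ ·) '' D) (hD.image _) (by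
    rintro _ ⟨c, hc, rfl⟩ _ ⟨d, hd, rfl⟩
    obtain ⟨e, he, hce, hde⟩ := hD' c hc d hd
    exact ⟨_, ⟨e, he, rfl⟩, union_subset_union_right a hce, union_subset_union_right a hde⟩) (by
    refine hup ?_ hmem
    obtain ⟨d, hd⟩ := hD
    rintro x (hx | ⟨c, hc, hx⟩)
    · exact ⟨_, ⟨d, hd, rfl⟩, Or.inl hx⟩
    · exact ⟨_, ⟨c, hc, rfl⟩, Or.inr hx⟩)
  exact ⟨d, hd, hdB⟩

variable [Countable H]

/-- `P ⊑ Q` iff `P(a, B) ≤ Q(a, B)` for every `a` and every Scott-open `B`. -/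
instance : PartialOrder (MKernel H) where
  le P Q := ∀ a B, ScottOpen B → P.ker a B ≤ Q.ker a B
  le_refl P a B _ := le_rfl
  le_trans P Q R h₁ h₂ a B hB := (h₁ a B hB).trans (h₂ a B hB)
  le_antisymm P Q h₁ h₂ := by
    obtain ⟨P, _⟩ := P
    obtain ⟨Q, _⟩ := Q
    congr 1
    refine DFunLike.ext _ _ fun a => ?_
    refine ext_of_generate_finite _ generateFrom_basicSets isPiSystem_basicSets ?_ (by simp)
    rintro _ ⟨b, rfl⟩
    exact le_antisymm (h₁ a _ (scottOpen_basicUnion _)) (h₂ a _ (scottOpen_basicUnion _))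

theorem le_def {P Q : MKernel H} : P ≤ Q ↔ ∀ a B, ScottOpen B → P.ker a B ≤ Q.ker a B := Iff.rfl

theorem exists_isLUB (P : ℕ → MKernel H) (hP : Monotone P) : ∃ Q, IsLUB (range P) Q := by
  choose ν hν hsup using fun a => exists_measure_iSup (fun n => (P n).ker a)
    fun B hB m n hmn => hP hmn a B hB
  have hmeas : Measurable ν := by
    refine Measurable.measure_of_isPiSystem_of_isProbabilityMeasure generateFrom_basicSets
      isPiSystem_basicSets ?_
    rintro _ ⟨b, rfl⟩
    simp_rw [hsup _ _ (scottOpen_basicUnion {b})]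
    refine .iSup fun n => (P n).ker.measurable_coe ?_
    rw [generateFrom_basicSets]
    exact MeasurableSpace.measurableSet_generateFrom ⟨b, rfl⟩
  refine ⟨⟨⟨ν, hmeas⟩, ⟨hν⟩⟩, ?_, ?_⟩
  · rintro _ ⟨n, rfl⟩ a B hB
    change _ ≤ ν a B
    rw [hsup a B hB]
    exact le_iSup (fun n => (P n).ker a B) n
  · intro R hR a B hB
    change ν a B ≤ _
    rw [hsup a B hB]
    exact iSup_le fun n => hR ⟨n, rfl⟩ a B hB

/-- The deterministic kernel `a ↦ δ_{f a}`. -/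
noncomputable def det (f : Set H → Set H) (hf : Measurable f) : MKernel H where
  ker := Kernel.deterministic f hf
  isMarkov := inferInstance

/-- The kernel `a ↦ δ_a`. -/
noncomputable def skip : MKernel H := det id measurable_id

/-- Parallel composition: `(P & Q)(a)` is the law of `b₁ ∪ b₂`, for independent samples `b₁`, `b₂`
of `P(a)`, `Q(a)`. -/
noncomputable def par (P Q : MKernel H) : MKernel H where
  ker := (Kernel.prod P.ker Q.ker).map fun x => x.1 ∪ x.2
  isMarkov := Kernel.IsMarkovKernel.map _ measurable_union

/-- Sequential composition: `(P ; Q)(a, A) = ∫ P(a, dc) Q(c, A)`. -/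
noncomputable def seq (P Q : MKernel H) : MKernel H where
  ker := Kernel.comp Q.ker P.ker
  isMarkov := inferInstance

/-- Probabilistic choice `r P + (1 - r) Q`. -/
noncomputable def choice (r : unitInterval) (P Q : MKernel H) : MKernel H where
  ker :=
    { toFun := fun a => ENNReal.ofReal r • P.ker a + ENNReal.ofReal (1 - (r : ℝ)) • Q.ker a
      measurable' := Measure.measurable_of_measurable_coe _ fun A hA =>
        ((P.ker.measurable_coe hA).const_mul (ENNReal.ofReal r)).add
          ((Q.ker.measurable_coe hA).const_mul (ENNReal.ofReal (1 - (r : ℝ)))) }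
  isMarkov := ⟨fun a => ⟨by
    change ENNReal.ofReal r * P.ker a univ + ENNReal.ofReal (1 - (r : ℝ)) * Q.ker a univ = 1
    rw [measure_univ, measure_univ, mul_one, mul_one,
      ← ENNReal.ofReal_add r.2.1 (sub_nonneg.2 r.2.2)]
    simp⟩⟩

/-- Negation: `(¬P)(a)` is the law of `a \ b`, for `b` a sample of `P(a)`. -/
noncomputable def neg (P : MKernel H) : MKernel H where
  ker := (Kernel.prod Kernel.id P.ker).map fun x => x.1 \ x.2
  isMarkov := Kernel.IsMarkovKernel.map _ measurable_sdiff

/-- Bounded iteration: `P⁽⁰⁾ = skip`, `P⁽ⁿ⁺¹⁾ = skip & (P ; P⁽ⁿ⁾)`. -/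
noncomputable def iter (P : MKernel H) : ℕ → MKernel H
  | 0 => skip
  | n + 1 => par skip (seq P (iter P n))

theorem skip_par_apply (P : MKernel H) (a : Set H) {B : Set (Set H)} (hB : ScottOpen B) :
    (par skip P).ker a B = P.ker a {b | a ∪ b ∈ B} := by
  have hm := measurableSet_of_scottOpen hB
  change ((Kernel.prod (Kernel.deterministic id measurable_id) P.ker).map _) a B = _
  rw [Kernel.map_apply' _ measurable_union _ hm,
    Kernel.deterministic_prod_apply' _ _ _ (measurable_union hm)]
  rfl

theorem monotone_iter (P : MKernel H) : Monotone (iter P) := by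
  refine monotone_nat_of_le_succ fun n => ?_
  induction n with
  | zero =>
    intro a B hB
    change Kernel.deterministic id measurable_id a B ≤ (par skip _).ker a B
    have hm := measurableSet_of_scottOpen hB
    rw [skip_par_apply _ a hB, Kernel.deterministic_apply' _ _ hm]
    by_cases ha : a ∈ B
    · have : {b | a ∪ b ∈ B} = univ :=
        eq_univ_of_forall fun b => (scottOpen_iff.1 hB).1 subset_union_left ha
      rw [this]
      simp [ha]
    · simp [ha]
  | succ n ih =>
    intro a B hB
    change (par skip _).ker a B ≤ (par skip _).ker a B
    rw [skip_par_apply _ a hB, skip_par_apply _ a hB]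
    have hB' := scottOpen_union a hB
    have hm := measurableSet_of_scottOpen hB'
    change (Kernel.comp _ _) a _ ≤ (Kernel.comp _ _) a _
    rw [Kernel.comp_apply' _ _ _ hm, Kernel.comp_apply' _ _ _ hm]
    exact lintegral_mono fun c => ih c _ hB'

/-- Iteration: the supremum of the chain `P⁽⁰⁾ ⊑ P⁽¹⁾ ⊑ …`. -/
noncomputable def star (P : MKernel H) : MKernel H :=
  (exists_isLUB (iter P) (monotone_iter P)).choose

theorem isLUB_star (P : MKernel H) : IsLUB (range (iter P)) (star P) :=
  (exists_isLUB (iter P) (monotone_iter P)).choose_spec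

end MKernel

/-! ### Syntax and semantics -/

/-- Packets: records over `k` fields, where field `f` ranges over the integers below `m f`. -/
abbrev Packet {k : ℕ} (m : Fin k → ℕ) : Type := (f : Fin k) → Fin (m f)

/-- Histories: nonempty lists of packets, split into the head packet and the tail. -/
structure Hist {k : ℕ} (m : Fin k → ℕ) : Type where
  head : Packet m
  tail : List (Packet m)

instance {k : ℕ} (m : Fin k → ℕ) : Countable (Hist m) :=
  Function.Injective.countable (f := fun h : Hist m => (h.head, h.tail)) fun h h' e => by
    cases h
    cases h'
    simpa using e

/-- Predicates. -/
inductive Pred {k : ℕ} (m : Fin k → ℕ) : Type where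
  | drop : Pred m
  | skip : Pred m
  | test (f : Fin k) (n : Fin (m f)) : Pred m
  | or (t u : Pred m) : Pred m
  | and (t u : Pred m) : Pred m
  | not (t : Pred m) : Pred m

/-- Programs. -/
inductive Prog {k : ℕ} (m : Fin k → ℕ) : Type where
  | filter (t : Pred m) : Prog m
  | modify (f : Fin k) (n : Fin (m f)) : Prog m
  | dup : Prog m
  | par (p q : Prog m) : Prog m
  | seq (p q : Prog m) : Prog m
  | choice (r : unitInterval) (p q : Prog m) : Prog m
  | star (p : Prog m) : Prog m

section Semantics

variable {k : ℕ} {m : Fin k → ℕ}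

theorem measurable_image {H : Type} [Countable H] (f : H → H) :
    Measurable fun a : Set H => f '' a := by
  refine measurable_set_iff.2 fun h => measurableSet_setOfPred.1 ?_
  have : {a : Set H | h ∈ f '' a} = ⋃ h' : {h' : H // f h' = h}, {a | (h' : H) ∈ a} := by
    ext a
    simp [and_comm]
  rw [this]
  exact .iUnion fun h' => measurableSet_mem _

theorem measurable_sep {H : Type} (p : H → Prop) : Measurable fun a : Set H => {h ∈ a | p h} :=
  measurable_set_iff.2 fun h => measurableSet_setOfPred.1
    ((measurableSet_mem h).inter (.const (p h)))

/-- `π:ħ ↦ π[f := n]:ħ` -/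
def Hist.modify (f : Fin k) (n : Fin (m f)) (h : Hist m) : Hist m :=
  ⟨Function.update h.head f n, h.tail⟩

/-- `π:ħ ↦ π:π:ħ` -/
def Hist.dup (h : Hist m) : Hist m := ⟨h.head, h.head :: h.tail⟩

/-- Denotation of predicates. -/
noncomputable def Pred.den : Pred m → MKernel (Hist m)
  | .drop => .det (fun _ => ∅) measurable_const
  | .skip => .skip
  | .test f n => .det (fun a => {h ∈ a | h.head f = n}) (measurable_sep _)
  | .or t u => .par t.den u.den
  | .and t u => .seq t.den u.den
  | .not t => .neg t.den

/-- Denotation of programs. -/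
noncomputable def Prog.den : Prog m → MKernel (Hist m)
  | .filter t => t.den
  | .modify f n => .det (fun a => Hist.modify f n '' a) (measurable_image _)
  | .dup => .det (fun a => Hist.dup '' a) (measurable_image _)
  | .par p q => .par p.den q.den
  | .seq p q => .seq p.den q.den
  | .choice r p q => .choice r p.den q.den
  | .star p => .star p.den

/-- The program `p⁽ⁿ⁾`: `p⁽⁰⁾ = skip`, `p⁽ⁿ⁺¹⁾ = skip & (p ; p⁽ⁿ⁾)`. -/
def Prog.iter (p : Prog m) : ℕ → Prog m
  | 0 => .filter .skip
  | n + 1 => .par (.filter .skip) (.seq p (Prog.iter p n))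

theorem Prog.den_iter (p : Prog m) (n : ℕ) : (p.iter n).den = p.den.iter n := by
  induction n with
  | zero => rfl
  | succ n ih =>
    change MKernel.par .skip (.seq p.den (p.iter n).den) = _
    rw [ih]
    rfl

/-- The denotation of `p*` is the supremum of the denotations of the `p⁽ⁿ⁾`. -/
theorem Prog.isLUB_den_star (p : Prog m) :
    IsLUB (range fun n => (p.iter n).den) (Prog.star p).den := by
  simp_rw [Prog.den_iter]
  exact MKernel.isLUB_star p.den

/-- The `n`-th approximant of a program: every `q*` is replaced by the bounded iteration of the
approximant of `q`. -/
def Prog.approx : Prog m → ℕ → Prog m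
  | .filter t, _ => .filter t
  | .modify f i, _ => .modify f i
  | .dup, _ => .dup
  | .par p q, n => .par (p.approx n) (q.approx n)
  | .seq p q, n => .seq (p.approx n) (q.approx n)
  | .choice r p q, n => .choice r (p.approx n) (q.approx n)
  | .star p, n => (p.approx n).iter n

end Semantics

end ProbNetKAT

/-! The order only sees the numbers P(a, B) with B Scott-open, so the natural strengthening of the
theorem is pointwise: for each a and each such B, the values of the approximants increase to the
value of the program (`IsLimit`). This gives both the chain and its least upper bound, and unlike a
bare least upper bound it can be pushed through the operations by induction on the program.

Both compositions are integrals in which measure and integrand vary together: Q(a, {b' | b ∪ b' ∈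
B}) or Q(b, B) is integrated against P(a, db). If the integrand f is continuous along increasing
sequences of sets, its superlevel sets are Scott-open, so the layer cake formula and monotone
convergence pass the limit of measures through ∫ f (`IsScottLimit.lintegral`). Monotone convergence
handles the varying integrand, and the resulting double supremum is attained on its diagonal. For
sequential composition the integrand is continuous only if the kernel is continuous in its argument,
hence a separate induction (`Prog.scottContinuous_den`).

For iteration, the i-fold iterates of the n-th approximant increase in both i and n, and the
approximant of a star is again the diagonal. Negation, which reverses the order, occurs only inside
predicates, and approximation leaves these unchanged. -/

namespace ProbNetKAT

/-! ### Limits of measures on Scott-open sets, and integration of continuous functions -/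

section ScottLimit

variable {H : Type}

/-- `μ` is the limit of the increasing sequence `μs`, measured on Scott-open sets. -/
def IsScottLimit (μs : ℕ → Measure (Set H)) (μ : Measure (Set H)) : Prop :=
  ∀ B, ScottOpen B → Monotone (fun n => μs n B) ∧ μ B = ⨆ n, μs n B

/-- A function on `Set H` that is increasing and preserves suprema of increasing sequences. -/
def OmegaContinuous (f : Set H → ℝ≥0∞) : Prop :=
  ∀ a : ℕ → Set H, Monotone a → Monotone (fun n => f (a n)) ∧ f (⋃ n, a n) = ⨆ n, f (a n)

theorem isScottLimit_const (μ : Measure (Set H)) : IsScottLimit (fun _ => μ) μ :=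
  fun _ _ => ⟨monotone_const, ciSup_const.symm⟩

theorem ScottOpen.exists_mem_of_iUnion_mem {B : Set (Set H)} (hB : ScottOpen B) {a : ℕ → Set H}
    (ha : Monotone a) (h : ⋃ n, a n ∈ B) : ∃ n, a n ∈ B := by
  obtain ⟨_, ⟨n, rfl⟩, hn⟩ := (scottOpen_iff.1 hB).2 (range a) (range_nonempty a)
    ha.directed_le.directedOn_range (by rwa [sUnion_range])
  exact ⟨n, hn⟩

theorem ScottOpen.mem_mono {B : Set (Set H)} (hB : ScottOpen B) {a b : Set H} (hab : a ⊆ b)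
    (ha : a ∈ B) : b ∈ B :=
  (scottOpen_iff.1 hB).1 hab ha

theorem OmegaContinuous.monotone {f : Set H → ℝ≥0∞} (hf : OmegaContinuous f) : Monotone f := by
  intro a b hab
  -- Continuity is tested on the sequence a, b, b, ….
  have hm : Monotone fun n : ℕ => if n = 0 then a else b := by
    refine monotone_nat_of_le_succ fun n => ?_
    by_cases hn : n = 0 <;> simp [hn, hab]
  simpa using (hf _ hm).1 (Nat.zero_le 1)

theorem OmegaContinuous.iSup {f : ℕ → Set H → ℝ≥0∞} (hf : ∀ n, OmegaContinuous (f n)) :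
    OmegaContinuous fun a => ⨆ n, f n a := fun a ha =>
  ⟨fun i j hij => iSup_mono fun n => (hf n a ha).1 hij, by
    simp_rw [fun n => (hf n a ha).2]
    exact iSup_comm⟩

variable [Countable H]

/-- Countability of `H` lets sequences control all directed families: the union of `D` is an
increasing union of finite sets `c n`, so f already exceeds r at some `c n`, and by directedness
this finite set lies inside a single member of `D`. -/
theorem OmegaContinuous.scottOpen_lt {f : Set H → ℝ≥0∞} (hf : OmegaContinuous f) (r : ℝ≥0∞) :
    ScottOpen {a | r < f a} := by
  refine scottOpen_iff.2 ⟨fun a b hab ha => lt_of_lt_of_le ha (hf.monotone hab), ?_⟩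
  intro D hD hdir hr
  obtain ⟨e, he⟩ := exists_injective_nat H
  let c : ℕ → Set H := fun n => {h ∈ ⋃₀ D | e h < n}
  have hc : Monotone c := fun i j hij h hh => ⟨hh.1, hh.2.trans_le hij⟩
  have hU : ⋃ n, c n = ⋃₀ D := by
    ext h
    simp only [mem_iUnion]
    exact ⟨fun ⟨_, hn⟩ => hn.1, fun hh => ⟨e h + 1, hh, Nat.lt_succ_self _⟩⟩
  have hr' : r < ⨆ n, f (c n) := by
    rw [← (hf c hc).2, hU]
    exact hr
  obtain ⟨n, hn⟩ := lt_iSup_iff.1 hr'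
  have hfin : (c n).Finite := by
    refine ((finite_Iio n).preimage he.injOn).subset fun h hh => ?_
    exact hh.2
  obtain ⟨d, hd, hcd⟩ := hdir.exists_mem_subset_of_finset_subset_biUnion hD
    (s := hfin.toFinset) (f := fun x => x) (by
      rw [hfin.coe_toFinset, ← sUnion_eq_biUnion]
      exact fun h hh => hh.1)
  rw [hfin.coe_toFinset] at hcd
  exact ⟨d, hd, lt_of_lt_of_le hn (hf.monotone hcd)⟩

theorem OmegaContinuous.measurable {f : Set H → ℝ≥0∞} (hf : OmegaContinuous f) : Measurable f :=
  measurable_of_Ioi fun r => measurableSet_of_scottOpen (hf.scottOpen_lt r)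

/-- The layer cake formula with the superlevel sets of an `ℝ≥0∞`-valued function. -/
theorem OmegaContinuous.lintegral_eq {f : Set H → ℝ≥0∞} (hf : OmegaContinuous f)
    (hf1 : ∀ a, f a ≤ 1) (μ : Measure (Set H)) :
    ∫⁻ a, f a ∂μ = ∫⁻ t in Ioi (0 : ℝ), μ {a | ENNReal.ofReal t < f a} := by
  -- The bound by 1 serves only to exclude ∞, which `toReal` would send to 0.
  have htop : ∀ a, f a ≠ ∞ := fun a => ne_top_of_le_ne_top ENNReal.one_ne_top (hf1 a)
  have h := lintegral_eq_lintegral_meas_lt μ (f := fun a => (f a).toReal)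
    (.of_forall fun a => ENNReal.toReal_nonneg) hf.measurable.ennreal_toReal.aemeasurable
  simp_rw [ENNReal.ofReal_toReal (htop _)] at h
  rw [h]
  refine setLIntegral_congr_fun measurableSet_Ioi fun t ht => ?_
  simp_rw [ENNReal.ofReal_lt_iff_lt_toReal (le_of_lt ht) (htop _)]

/-- By the layer cake formula the integral depends on the measure only through the Scott-open
superlevel sets of f, where the measures increase to their limit; monotone convergence in the level
t then applies. -/
theorem IsScottLimit.lintegral {μs : ℕ → Measure (Set H)} {μ : Measure (Set H)}
    (hμ : IsScottLimit μs μ) {f : Set H → ℝ≥0∞} (hf : OmegaContinuous f) (hf1 : ∀ a, f a ≤ 1) :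
    Monotone (fun n => ∫⁻ a, f a ∂μs n) ∧ ∫⁻ a, f a ∂μ = ⨆ n, ∫⁻ a, f a ∂μs n := by
  simp_rw [hf.lintegral_eq hf1]
  refine ⟨fun i j hij => lintegral_mono fun t => (hμ _ (hf.scottOpen_lt _)).1 hij, ?_⟩
  simp_rw [fun t : ℝ => (hμ _ (hf.scottOpen_lt (ENNReal.ofReal t))).2]
  refine lintegral_iSup (fun n => ?_) fun i j hij t => (hμ _ (hf.scottOpen_lt _)).1 hij
  -- Monotone convergence needs measurability in t, which follows from antitonicity.
  have : Antitone fun t : ℝ => μs n {a | ENNReal.ofReal t < f a} := fun s t hst =>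
    measure_mono fun a ha => lt_of_le_of_lt (ENNReal.ofReal_le_ofReal hst) ha
  exact this.measurable

/-- The supremum of a family that increases in both indices is attained on the diagonal. -/
theorem iSup_iSup_eq_iSup_diag {u : ℕ → ℕ → ℝ≥0∞} (h₁ : ∀ j, Monotone fun i => u i j)
    (h₂ : ∀ i, Monotone (u i)) : ⨆ i, ⨆ j, u i j = ⨆ n, u n n :=
  le_antisymm
    (iSup_le fun i => iSup_le fun j => ((h₁ j (le_max_left i j)).trans
      (h₂ _ (le_max_right i j))).trans (le_iSup (fun n => u n n) (max i j)))
    (iSup_le fun n => (le_iSup (u n) n).trans (le_iSup (fun i => ⨆ j, u i j) n))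

theorem IsScottLimit.lintegral_diag {μs : ℕ → Measure (Set H)} {μ : Measure (Set H)}
    (hμ : IsScottLimit μs μ) {f : ℕ → Set H → ℝ≥0∞} {g : Set H → ℝ≥0∞}
    (hf : ∀ n, OmegaContinuous (f n)) (hf1 : ∀ n a, f n a ≤ 1) (hmono : ∀ a, Monotone fun n => f n a)
    (hg : ∀ a, g a = ⨆ n, f n a) :
    Monotone (fun n => ∫⁻ a, f n a ∂μs n) ∧ ∫⁻ a, g a ∂μ = ⨆ n, ∫⁻ a, f n a ∂μs n := by
  have h₁ := fun n => (hμ.lintegral (hf n) (hf1 n)).1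
  have h₂ : ∀ i, Monotone fun n => ∫⁻ a, f n a ∂μs i := fun i m n hmn =>
    lintegral_mono fun a => hmono a hmn
  refine ⟨fun i j hij => (h₁ i hij).trans (h₂ j hij), ?_⟩
  simp_rw [hg]
  -- First the integrand varies under the limit measure, then the measure varies for each fixed
  -- integrand; the two suprema merge on the diagonal.
  rw [lintegral_iSup (fun n => (hf n).measurable) fun i j hij a => hmono a hij]
  simp_rw [fun n => (hμ.lintegral (hf n) (hf1 n)).2]
  exact iSup_iSup_eq_iSup_diag (u := fun i j => ∫⁻ a, f i a ∂μs j) h₂ h₁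

end ScottLimit

/-! ### Continuity and pointwise limits of kernels -/

namespace MKernel

variable {H : Type}

/-- Kernels that are continuous maps from sets to measures, for the order on Scott-open sets. -/
def ScottContinuous (P : MKernel H) : Prop :=
  ∀ a : ℕ → Set H, Monotone a → IsScottLimit (fun n => P.ker (a n)) (P.ker (⋃ n, a n))

/-- Pointwise limits of increasing sequences of kernels. -/
def IsLimit (P : ℕ → MKernel H) (Q : MKernel H) : Prop :=
  ∀ a, IsScottLimit (fun n => (P n).ker a) (Q.ker a)

theorem isLimit_const (P : MKernel H) : IsLimit (fun _ => P) P := fun _ => isScottLimit_const _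

theorem IsLimit.monotone {P : ℕ → MKernel H} {Q : MKernel H} (h : IsLimit P Q) : Monotone P :=
  fun _ _ hij a B hB => (h a B hB).1 hij

theorem IsLimit.isLUB {P : ℕ → MKernel H} {Q : MKernel H} (h : IsLimit P Q) :
    IsLUB (range P) Q := by
  refine ⟨?_, fun R hR a B hB => ?_⟩
  · rintro _ ⟨n, rfl⟩ a B hB
    rw [(h a B hB).2]
    exact le_iSup (fun n => (P n).ker a B) n
  · rw [(h a B hB).2]
    exact iSup_le fun n => hR ⟨n, rfl⟩ a B hB

theorem ScottContinuous.omegaContinuous {P : MKernel H} (hP : P.ScottContinuous)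
    {B : Set (Set H)} (hB : ScottOpen B) : OmegaContinuous fun a => P.ker a B :=
  fun a ha => hP a ha B hB

theorem det_apply (f : Set H → Set H) (hf : Measurable f) (a : Set H) :
    (det f hf).ker a = Measure.dirac (f a) :=
  Kernel.deterministic_apply hf a

theorem choice_apply (r : unitInterval) (P Q : MKernel H) (a : Set H) (B : Set (Set H)) :
    (choice r P Q).ker a B =
      ENNReal.ofReal r * P.ker a B + ENNReal.ofReal (1 - (r : ℝ)) * Q.ker a B := rfl

/-- Probabilistic choice is jointly continuous in the kernels and their arguments. -/
theorem isScottLimit_choice (r : unitInterval) {P Q : ℕ → MKernel H} {P' Q' : MKernel H}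
    {a : ℕ → Set H} {a' : Set H} (hP : IsScottLimit (fun n => (P n).ker (a n)) (P'.ker a'))
    (hQ : IsScottLimit (fun n => (Q n).ker (a n)) (Q'.ker a')) :
    IsScottLimit (fun n => (choice r (P n) (Q n)).ker (a n)) ((choice r P' Q').ker a') := by
  intro B hB
  have h₁ : Monotone fun n => ENNReal.ofReal r * (P n).ker (a n) B :=
    fun i j hij => mul_le_mul_right ((hP B hB).1 hij) _
  have h₂ : Monotone fun n => ENNReal.ofReal (1 - (r : ℝ)) * (Q n).ker (a n) B :=
    fun i j hij => mul_le_mul_right ((hQ B hB).1 hij) _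
  simp_rw [choice_apply]
  refine ⟨h₁.add h₂, ?_⟩
  rw [(hP B hB).2, (hQ B hB).2, ENNReal.mul_iSup, ENNReal.mul_iSup,
    ENNReal.iSup_add_iSup_of_monotone h₁ h₂]

/-- Two suprema commute. This transfers continuity from the bounded iterations to the star. -/
theorem IsLimit.scottContinuous {P : ℕ → MKernel H} {Q : MKernel H} (h : IsLimit P Q)
    (hP : ∀ n, (P n).ScottContinuous) : Q.ScottContinuous := by
  intro a ha B hB
  have := OmegaContinuous.iSup (fun n => (hP n).omegaContinuous hB) a ha
  simpa only [← (h _ B hB).2] using this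

/-- Since B is Scott-open, the sets {b' | a n ∪ b' ∈ B} increase to the one for the union of the `a
n`; continuity of ν from below finishes. -/
theorem omegaContinuous_measure_union (ν : Measure (Set H)) {B : Set (Set H)} (hB : ScottOpen B) :
    OmegaContinuous fun b => ν {b' | b ∪ b' ∈ B} := by
  intro a ha
  have hmono : Monotone fun n => {b' | a n ∪ b' ∈ B} := fun i j hij b' hb' =>
    hB.mem_mono (union_subset_union_left b' (ha hij)) hb'
  refine ⟨fun i j hij => measure_mono (hmono hij), ?_⟩
  rw [← hmono.measure_iUnion]
  refine congrArg ν ?_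
  ext b'
  simp only [mem_iUnion, mem_ofPred_eq]
  constructor
  · intro h
    rw [iUnion_union] at h
    exact hB.exists_mem_of_iUnion_mem
      (fun i j hij => union_subset_union_left b' (ha hij)) h
  · rintro ⟨n, hn⟩
    exact hB.mem_mono (union_subset_union_left b' (subset_iUnion a n)) hn

theorem ScottContinuous.choice (r : unitInterval) {P Q : MKernel H} (hP : P.ScottContinuous)
    (hQ : Q.ScottContinuous) : (MKernel.choice r P Q).ScottContinuous := fun a ha =>
  isScottLimit_choice r (P := fun _ => P) (Q := fun _ => Q) (hP a ha) (hQ a ha)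

variable [Countable H]

theorem exists_isLimit (P : ℕ → MKernel H) (hP : Monotone P) : ∃ Q, IsLimit P Q := by
  choose ν hν hsup using fun a => exists_measure_iSup (fun n => (P n).ker a)
    fun B hB m n hmn => hP hmn a B hB
  have hmeas : Measurable ν := by
    refine Measurable.measure_of_isPiSystem_of_isProbabilityMeasure generateFrom_basicSets
      isPiSystem_basicSets ?_
    rintro _ ⟨b, rfl⟩
    simp_rw [hsup _ _ (scottOpen_basicUnion {b})]
    exact .iSup fun n =>
      (P n).ker.measurable_coe (measurableSet_of_scottOpen (scottOpen_basicUnion {b}))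
  exact ⟨⟨⟨ν, hmeas⟩, ⟨hν⟩⟩, fun a B hB => ⟨fun i j hij => hP hij a B hB, hsup a B hB⟩⟩

/-- Some pointwise limit exists and is a least upper bound, so uniqueness identifies it with the
given one. This yields the values of `star`, which is specified only as a least upper bound. -/
theorem isLimit_of_isLUB {P : ℕ → MKernel H} {Q : MKernel H} (hP : Monotone P)
    (hQ : IsLUB (range P) Q) : IsLimit P Q := by
  obtain ⟨R, hR⟩ := exists_isLimit P hP
  rwa [hQ.unique hR.isLUB]

theorem isLimit_star (P : MKernel H) : IsLimit (iter P) (star P) :=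
  isLimit_of_isLUB (monotone_iter P) (isLUB_star P)

/-- A Dirac mass at `f a` gives B the indicator of `f a ∈ B`, so everything reduces to membership in
B. Only one inclusion is assumed in `hU`; monotonicity of f supplies the other. -/
theorem scottContinuous_of_dirac {P : MKernel H} {f : Set H → Set H}
    (hP : ∀ a, P.ker a = Measure.dirac (f a)) (hf : Monotone f)
    (hU : ∀ a : ℕ → Set H, Monotone a → f (⋃ n, a n) ⊆ ⋃ n, f (a n)) : P.ScottContinuous := by
  intro a ha B hB
  simp_rw [hP]
  have hm := measurableSet_of_scottOpen hB
  have hle : ∀ {x y : Set H}, (x ∈ B → y ∈ B) → Measure.dirac x B ≤ Measure.dirac y B := by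
    intro x y hxy
    rw [Measure.dirac_apply' _ hm, Measure.dirac_apply' _ hm]
    by_cases hx : x ∈ B
    · simp [hx, hxy hx]
    · simp [hx]
  refine ⟨fun i j hij => hle (hB.mem_mono (hf (ha hij))), le_antisymm ?_ ?_⟩
  · by_cases hx : f (⋃ n, a n) ∈ B
    · obtain ⟨n, hn⟩ := hB.exists_mem_of_iUnion_mem (hf.comp ha) (hB.mem_mono (hU a ha) hx)
      exact (hle fun _ => hn).trans (le_iSup (fun n => Measure.dirac (f (a n)) B) n)
    · rw [Measure.dirac_apply' _ hm]
      simp [hx]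
  · exact iSup_le fun n => hle (hB.mem_mono (hf (subset_iUnion a n)))

theorem scottContinuous_skip : (skip : MKernel H).ScottContinuous :=
  scottContinuous_of_dirac (det_apply _ _) monotone_id fun _ _ => Subset.rfl

theorem scottContinuous_det_image (f : H → H) (hf : Measurable fun a : Set H => f '' a) :
    (det (fun a => f '' a) hf).ScottContinuous :=
  scottContinuous_of_dirac (det_apply _ _) (fun _ _ h => image_mono h)
    fun _ _ => (image_iUnion).subset

/-! ### Continuity of composition and iteration -/

theorem par_apply (P Q : MKernel H) (a : Set H) {B : Set (Set H)} (hB : ScottOpen B) :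
    (par P Q).ker a B = ∫⁻ b, Q.ker a {b' | b ∪ b' ∈ B} ∂P.ker a := by
  have hm := measurableSet_of_scottOpen hB
  change ((Kernel.prod P.ker Q.ker).map _) a B = _
  rw [Kernel.map_apply' _ measurable_union _ hm, Kernel.prod_apply' _ _ _ (measurable_union hm)]
  rfl

theorem seq_apply (P Q : MKernel H) (a : Set H) {B : Set (Set H)} (hB : ScottOpen B) :
    (seq P Q).ker a B = ∫⁻ b, Q.ker b B ∂P.ker a :=
  Kernel.comp_apply' _ _ _ (measurableSet_of_scottOpen hB)

/-- Parallel composition is jointly continuous in the kernels and their arguments. -/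
theorem isScottLimit_par {P Q : ℕ → MKernel H} {P' Q' : MKernel H} {a : ℕ → Set H} {a' : Set H}
    (hP : IsScottLimit (fun n => (P n).ker (a n)) (P'.ker a'))
    (hQ : IsScottLimit (fun n => (Q n).ker (a n)) (Q'.ker a')) :
    IsScottLimit (fun n => (par (P n) (Q n)).ker (a n)) ((par P' Q').ker a') := by
  intro B hB
  simp_rw [par_apply _ _ _ hB]
  exact hP.lintegral_diag (fun n => omegaContinuous_measure_union _ hB) (fun _ _ => prob_le_one)
    (fun b => (hQ _ (scottOpen_union b hB)).1) fun b => (hQ _ (scottOpen_union b hB)).2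

/-- Sequential composition is jointly continuous in the kernels and their arguments. -/
theorem isScottLimit_seq {P Q : ℕ → MKernel H} {P' Q' : MKernel H} {a : ℕ → Set H} {a' : Set H}
    (hP : IsScottLimit (fun n => (P n).ker (a n)) (P'.ker a'))
    (hc : ∀ n, (Q n).ScottContinuous) (hQ : IsLimit Q Q') :
    IsScottLimit (fun n => (seq (P n) (Q n)).ker (a n)) ((seq P' Q').ker a') := by
  intro B hB
  simp_rw [seq_apply _ _ _ hB]
  exact hP.lintegral_diag (fun n => (hc n).omegaContinuous hB) (fun _ _ => prob_le_one)
    (fun b => (hQ b B hB).1) fun b => (hQ b B hB).2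

theorem ScottContinuous.par {P Q : MKernel H} (hP : P.ScottContinuous) (hQ : Q.ScottContinuous) :
    (MKernel.par P Q).ScottContinuous := fun a ha =>
  isScottLimit_par (P := fun _ => P) (Q := fun _ => Q) (hP a ha) (hQ a ha)

theorem ScottContinuous.seq {P Q : MKernel H} (hP : P.ScottContinuous) (hQ : Q.ScottContinuous) :
    (MKernel.seq P Q).ScottContinuous := fun a ha =>
  isScottLimit_seq (P := fun _ => P) (Q := fun _ => Q) (hP a ha) (fun _ => hQ) (isLimit_const Q)

theorem ScottContinuous.iter {P : MKernel H} (hP : P.ScottContinuous) (n : ℕ) :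
    (MKernel.iter P n).ScottContinuous := by
  induction n with
  | zero => exact scottContinuous_skip
  | succ n ih => exact scottContinuous_skip.par (hP.seq ih)

theorem IsLimit.iter {P : ℕ → MKernel H} {Q : MKernel H} (h : IsLimit P Q)
    (hP : ∀ n, (P n).ScottContinuous) (i : ℕ) :
    IsLimit (fun n => MKernel.iter (P n) i) (MKernel.iter Q i) := by
  induction i with
  | zero => exact isLimit_const _
  | succ i ih =>
    exact fun a => isScottLimit_par (P := fun _ => skip) (a := fun _ => a) (isScottLimit_const _)
      (isScottLimit_seq (a := fun _ => a) (h a) (fun n => (hP n).iter i) ih)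

/-- For a fixed number i of iterations the supremum over n gives `iter Q i`, and the supremum over i
gives `star Q`. Monotonicity in both indices allows the diagonal. -/
theorem IsLimit.star {P : ℕ → MKernel H} {Q : MKernel H} (h : IsLimit P Q)
    (hP : ∀ n, (P n).ScottContinuous) :
    IsLimit (fun n => MKernel.iter (P n) n) (MKernel.star Q) := by
  intro a B hB
  have h₁ : ∀ i, Monotone fun n => (MKernel.iter (P n) i).ker a B := fun i =>
    (h.iter hP i a B hB).1
  have h₂ : ∀ n, Monotone fun i => (MKernel.iter (P n) i).ker a B := fun n i j hij =>
    monotone_iter (P n) hij a B hB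
  refine ⟨fun i j hij => (h₁ i hij).trans (h₂ j hij), ?_⟩
  rw [(isLimit_star Q a B hB).2]
  simp_rw [fun i => (h.iter hP i a B hB).2]
  exact iSup_iSup_eq_iSup_diag (u := fun i n => (MKernel.iter (P n) i).ker a B) h₂ h₁

end MKernel

/-! ### Induction over predicates and programs -/

section Semantics

variable {k : ℕ} {m : Fin k → ℕ}

open MKernel

/-- Predicates denote deterministic filters. -/
theorem Pred.exists_den_eq_dirac (t : Pred m) :
    ∃ φ : Hist m → Prop, ∀ a, t.den.ker a = Measure.dirac {h ∈ a | φ h} := by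
  induction t with
  | drop => exact ⟨fun _ => False, fun a =>
    (det_apply (fun _ => ∅) measurable_const a).trans (congrArg _ (by simp))⟩
  | skip => exact ⟨fun _ => True, fun a =>
    (det_apply id measurable_id a).trans (congrArg _ (by simp))⟩
  | test f n => exact ⟨fun h => h.head f = n, fun a => det_apply _ _ a⟩
  | or t u iht ihu =>
    obtain ⟨φ, hφ⟩ := iht
    obtain ⟨ψ, hψ⟩ := ihu
    refine ⟨fun h => φ h ∨ ψ h, fun a => ?_⟩
    change ((Kernel.prod t.den.ker u.den.ker).map _) a = _
    rw [Kernel.map_apply _ measurable_union, Kernel.prod_apply, hφ, hψ, Measure.dirac_prod_dirac,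
      Measure.map_dirac' measurable_union]
    congr 1
    ext h
    simp only [mem_union, mem_ofPred_eq]
    tauto
  | and t u iht ihu =>
    obtain ⟨φ, hφ⟩ := iht
    obtain ⟨ψ, hψ⟩ := ihu
    refine ⟨fun h => φ h ∧ ψ h, fun a => ?_⟩
    change Kernel.comp u.den.ker t.den.ker a = _
    rw [Kernel.comp_apply, hφ, Measure.dirac_bind u.den.ker.measurable, hψ]
    congr 1
    ext h
    simp only [mem_ofPred_eq]
    tauto
  | not t iht =>
    obtain ⟨φ, hφ⟩ := iht
    refine ⟨fun h => ¬ φ h, fun a => ?_⟩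
    change ((Kernel.prod Kernel.id t.den.ker).map _) a = _
    rw [Kernel.map_apply _ measurable_sdiff, Kernel.prod_apply, hφ, Kernel.id_apply,
      Measure.dirac_prod_dirac, Measure.map_dirac' measurable_sdiff]
    congr 1
    ext h
    simp only [Set.mem_sdiff, mem_ofPred_eq]
    tauto

/-- Set difference reverses inclusion in its second argument, so continuity does not pass through
`not` compositionally. The explicit filter form avoids this: a ↦ {h ∈ a | φ h} preserves unions for
every φ. -/
theorem Pred.scottContinuous_den (t : Pred m) : t.den.ScottContinuous := by
  obtain ⟨φ, hφ⟩ := t.exists_den_eq_dirac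
  refine scottContinuous_of_dirac hφ (fun a b hab h hh => ⟨hab hh.1, hh.2⟩) fun a _ h hh => ?_
  obtain ⟨n, hn⟩ := mem_iUnion.1 hh.1
  exact mem_iUnion.2 ⟨n, hn, hh.2⟩

theorem Prog.scottContinuous_den (p : Prog m) : p.den.ScottContinuous := by
  induction p with
  | filter t => exact t.scottContinuous_den
  | modify f n => exact scottContinuous_det_image _ _
  | dup => exact scottContinuous_det_image _ _
  | par p q hp hq => exact hp.par hq
  | seq p q hp hq => exact hp.seq hq
  | choice r p q hp hq => exact hp.choice r hq
  | star p hp => exact (isLimit_star p.den).scottContinuous hp.iter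

theorem Prog.isLimit_den_approx (p : Prog m) : IsLimit (fun n => (p.approx n).den) p.den := by
  induction p with
  | filter t => exact isLimit_const _
  | modify f n => exact isLimit_const _
  | dup => exact isLimit_const _
  | par p q hp hq => exact fun a => isScottLimit_par (a := fun _ => a) (hp a) (hq a)
  | seq p q hp hq =>
    exact fun a => isScottLimit_seq (a := fun _ => a) (hp a)
      (fun n => (q.approx n).scottContinuous_den) hq
  | choice r p q hp hq => exact fun a => isScottLimit_choice r (a := fun _ => a) (hp a) (hq a)
  | star p hp =>
    -- The n-th approximant of the star now denotes the n-fold iterate of the n-th approximant of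
    -- its body.
    simp only [Prog.approx, Prog.den_iter]
    exact hp.star fun n => (p.approx n).scottContinuous_den

end Semantics

end ProbNetKAT

theorem mainTheorem10 {k : ℕ} (m : Fin k → ℕ) (p : ProbNetKAT.Prog m) :
    Monotone (fun n : ℕ => (p.approx n).den) ∧
      IsLUB (Set.range fun n : ℕ => (p.approx n).den) p.den :=
  ⟨p.isLimit_den_approx.monotone, p.isLimit_den_approx.isLUB⟩
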